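/- For a Hermitian $n\times n$ matrix $A$ with eigenvalues $\lambda_1\le\dots\le\lambda_n$ let $L_n^A=\frac1n\sum_{i=1}^n\delta_{\lambda_i}$ be its empirical spectral distribution. A random $n\times n$ matrix $X$ belongs to $\mathcal S(d)$ if there is a partition $\{P_1,\dots,P_k\}$ of $\{1,\dots,n\}^2$ with $|P_r|\le d$ for all $r$ such that the random vectors $(X_{ij})_{(i,j)\in P_r}$, $r=1,\dots,k$, are independent. **Theorem.** Let $(X_n)_{n\in\mathbb N}$ be a sequence of random matrices, where $X_n$ is $n\times n$, complex and Hermitian. Let $a_n\to\infty$ be a sequence of real numbers and let $(d_n)$ be a sequence of real numbers with $d_n=O(n^2/a_n^2)$ such that $X_n\in\mathcal S(d_n)$ for every $n$. Suppose that $(X_n)$ satisfies the Lindeberg-type condition $\mathcal L(a_n)$: $$\forall\,\varepsilon>0\qquad \limsup_{n\to\infty}\ \mathbb P\Big(\frac1{n^2}\sum_{i,j=1}^n |(X_n)_{ij}|^2\,\mathbf 1_{\{|(X_n)_{ij}|>\varepsilon a_n\}}>\varepsilon\Big)=0 .$$ Then for every compactly supported $1$-Lipschitz function $f:\mathbb R\to\mathbb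 R$ the random variables $\int f\,dL_n^{X_n/\sqrt n}$ are integrable and $$\int f\,dL_n^{X_n/\sqrt n}-\mathbb E\int f\,dL_n^{X_n/\sqrt n}\ \longrightarrow\ 0\quad\text{in probability as } n\to\infty .$$ -/

import Mathlib

open MeasureTheory ProbabilityTheory Filter Topology Asymptotics

noncomputable section

/-- The real vector space of Hermitian `n × n` complex matrices. -/
abbrev HermMat (n : ℕ) : Type := selfAdjoint (Matrix (Fin n) (Fin n) ℂ)

/-- A random `n × m` matrix has independent blocks of size at most `d`: the set of index pairs
has a partition into sets of at most `d` elements such that the random vectors formed by the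
entries with indices in the different parts are independent. -/
def IndepBlocks {Ω : Type*} [MeasurableSpace Ω] {n m : ℕ} (X : Ω → Matrix (Fin n) (Fin m) ℂ)
    (P : Measure Ω) (d : ℝ) : Prop :=
  ∃ Q : Finpartition (Finset.univ : Finset (Fin n × Fin m)),
    iIndepFun (fun (p : Q.parts) (ω : Ω) (q : p.1) => X ω q.1.1 q.1.2) P ∧
    ∀ p ∈ Q.parts, (p.card : ℝ) ≤ d

/-- The Lindeberg-type condition for a sequence of random matrices, truncated at multiples of
the sequence `a`. -/
def LindebergCond {Ω : ℕ → Type*} [∀ n, MeasurableSpace (Ω n)]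
    (X : ∀ n, Ω n → Matrix (Fin n) (Fin n) ℂ) (P : ∀ n, Measure (Ω n)) (a : ℕ → ℝ) : Prop :=
  ∀ ε : ℝ, 0 < ε →
    limsup (fun n : ℕ => P n {ω | ε < 1 / (n : ℝ) ^ 2 *
      ∑ i, ∑ j, if ε * a n < ‖X n ω i j‖ then ‖X n ω i j‖ ^ 2 else 0}) atTop = 0

/-- The empirical spectral distribution of a Hermitian matrix: mass `1 / n` at each of the `n`
eigenvalues, counted with multiplicity. -/
def empSpecDist {n : ℕ} (A : HermMat n) : Measure ℝ :=
  (n : ENNReal)⁻¹ •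
    ∑ i, Measure.dirac ((Matrix.isHermitian_iff_isSelfAdjoint.mpr A.2).eigenvalues i)

/-- Convergence to zero in probability of a sequence of real random variables, where the `n`-th
variable may live on its own probability space. -/
def TendstoZeroInProb {Ω : ℕ → Type*} [∀ n, MeasurableSpace (Ω n)]
    (Z : ∀ n, Ω n → ℝ) (P : ∀ n, Measure (Ω n)) : Prop :=
  ∀ ε : ℝ, 0 < ε → Tendsto (fun n => P n {ω | ε ≤ |Z n ω|}) atTop (𝓝 0)

end

/-! Why the theorem holds: a linear statistic `F` of a convex function is convex in the matrix
entries (Klein's inequality), with subgradients of Euclidean norm at most `K / n`. Convexity is what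
allows large blocks. By the one-sided Efron–Stein inequality, the variance is controlled by the
squared decreases of `F` under resampling one block, and a single subgradient at the current point
bounds all of these decreases at once. Its squared norm splits over the blocks, so entries bounded
by `t` and blocks of size at most `d` give variance at most `4 (K/n)² t² d`, whatever the number of
blocks. A Lipschitz bound alone would lose a factor equal to that number.

With `t = ε a_n` and `d = C n² / a_n²` this is `4 K² C ε²`. Truncation at `ε a_n` is harmless: by
Hoffman–Wielandt, linear statistics are `1/n`-Lipschitz in the Frobenius norm of the unscaled
matrix, and the Lindeberg condition makes the removed part small with high probability. A general
test function is, up to `δ`, a difference of convex functions with slopes bounded by some `K`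
depending on `δ`; so `δ` is fixed first and `ε` is chosen afterwards. -/

namespace Matrix.IsHermitian

/-! ### Spectral inequalities for pairs of Hermitian matrices -/

lemma trace_mul_self {ι : Type*} [Fintype ι] {A : Matrix ι ι ℂ} (hA : A.IsHermitian) :
    (A * A).trace = ((∑ i, ∑ j, ‖A i j‖ ^ 2 : ℝ) : ℂ) := by
  rw [Matrix.trace]
  push_cast
  refine Finset.sum_congr rfl fun i _ => ?_
  rw [Matrix.diag_apply, Matrix.mul_apply]
  refine Finset.sum_congr rfl fun j _ => ?_
  rw [← hA.apply j i, Complex.star_def, Complex.mul_conj, Complex.normSq_eq_norm_sq]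
  push_cast; rfl

variable {ι : Type*} [Fintype ι] [DecidableEq ι] {A B : Matrix ι ι ℂ}

/-- The function `φ` applied to a Hermitian matrix, through a chosen eigenbasis. -/
noncomputable def spectralMap (hA : A.IsHermitian) (φ : ℝ → ℝ) : Matrix ι ι ℂ :=
  (hA.eigenvectorUnitary : Matrix ι ι ℂ) * Matrix.diagonal (fun i => (φ (hA.eigenvalues i) : ℂ)) *
    star (hA.eigenvectorUnitary : Matrix ι ι ℂ)

/-- The squared modulus of the inner product of the `i`-th eigenvector of `A` and the `j`-th
eigenvector of `B`. -/
noncomputable def overlap (hA : A.IsHermitian) (hB : B.IsHermitian) (i j : ι) : ℝ :=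
  ‖(star (hA.eigenvectorUnitary : Matrix ι ι ℂ) *
    (hB.eigenvectorUnitary : Matrix ι ι ℂ)) i j‖ ^ 2

lemma overlap_nonneg (hA : A.IsHermitian) (hB : B.IsHermitian) (i j : ι) :
    0 ≤ hA.overlap hB i j := by
  unfold overlap; positivity

lemma spectralMap_id (hA : A.IsHermitian) : hA.spectralMap (fun x => x) = A := by
  conv_rhs => rw [hA.spectral_theorem, Unitary.conjStarAlgAut_apply]
  rfl

lemma spectralMap_isHermitian (hA : A.IsHermitian) (φ : ℝ → ℝ) :
    (hA.spectralMap φ).IsHermitian := by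
  unfold spectralMap Matrix.IsHermitian
  rw [← Matrix.star_eq_conjTranspose, star_mul, star_mul, star_star, ← mul_assoc]
  congr 2
  rw [Matrix.star_eq_conjTranspose, Matrix.diagonal_conjTranspose]
  congr 1
  ext i
  simp

lemma spectralMap_mul (hA : A.IsHermitian) (φ ψ : ℝ → ℝ) :
    hA.spectralMap φ * hA.spectralMap ψ = hA.spectralMap (fun x => φ x * ψ x) := by
  have h : star (hA.eigenvectorUnitary : Matrix ι ι ℂ) *
      (hA.eigenvectorUnitary : Matrix ι ι ℂ) = 1 := Unitary.coe_star_mul_self _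
  have hD : Matrix.diagonal (fun i => ((φ (hA.eigenvalues i) * ψ (hA.eigenvalues i) : ℝ) : ℂ)) =
      Matrix.diagonal (fun i => (φ (hA.eigenvalues i) : ℂ)) *
        Matrix.diagonal (fun i => (ψ (hA.eigenvalues i) : ℂ)) := by
    rw [Matrix.diagonal_mul_diagonal]; simp
  unfold spectralMap
  rw [hD]
  simp only [mul_assoc]
  rw [← mul_assoc (star (hA.eigenvectorUnitary : Matrix ι ι ℂ))
    (hA.eigenvectorUnitary : Matrix ι ι ℂ), h, one_mul]

lemma trace_spectralMap (hA : A.IsHermitian) (φ : ℝ → ℝ) :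
    (hA.spectralMap φ).trace = ((∑ i, φ (hA.eigenvalues i) : ℝ) : ℂ) := by
  unfold spectralMap
  rw [Matrix.trace_mul_comm, ← mul_assoc, Unitary.coe_star_mul_self, one_mul,
    Matrix.trace_diagonal]
  simp

lemma spectralMap_one (hA : A.IsHermitian) : hA.spectralMap (fun _ => 1) = 1 := by
  simp [spectralMap]

/-- With `W = U* V` for the two eigenbases, the trace becomes a sum over `‖W i j‖²`. Taking `φ` or
`ψ` to be `1` lets sums over either spectrum be written against the same weights, so trace
inequalities reduce to scalar inequalities for pairs of eigenvalues. -/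
lemma trace_spectralMap_mul_spectralMap (hA : A.IsHermitian) (hB : B.IsHermitian) (φ ψ : ℝ → ℝ) :
    (hA.spectralMap φ * hB.spectralMap ψ).trace =
      ((∑ i, ∑ j, hA.overlap hB i j * (φ (hA.eigenvalues i) * ψ (hB.eigenvalues j)) : ℝ) : ℂ) := by
  set U := (hA.eigenvectorUnitary : Matrix ι ι ℂ) with hU
  set V := (hB.eigenvectorUnitary : Matrix ι ι ℂ) with hV
  set W := star U * V with hW
  have hWs : star V * U = star W := by rw [hW, star_mul, star_star]
  set D := Matrix.diagonal (fun i => (φ (hA.eigenvalues i) : ℂ)) with hD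
  set E := Matrix.diagonal (fun i => (ψ (hB.eigenvalues i) : ℂ)) with hE
  have h1 : (hA.spectralMap φ * hB.spectralMap ψ).trace = (D * W * (E * star W)).trace := by
    change (U * D * star U * (V * E * star V)).trace = _
    calc (U * D * star U * (V * E * star V)).trace
        = (U * (D * star U * (V * E * star V))).trace := by simp only [mul_assoc]
      _ = ((D * star U * (V * E * star V)) * U).trace := Matrix.trace_mul_comm _ _
      _ = _ := by rw [← hWs, hW]; simp only [mul_assoc]
  rw [h1, Matrix.trace]
  push_cast
  refine Finset.sum_congr rfl fun i _ => ?_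
  rw [Matrix.diag_apply, Matrix.mul_apply]
  refine Finset.sum_congr rfl fun j _ => ?_
  rw [hD, hE, Matrix.diagonal_mul, Matrix.diagonal_mul, Matrix.star_apply]
  have : ((hA.overlap hB i j : ℝ) : ℂ) = W i j * star (W i j) := by
    rw [overlap, Complex.star_def, Complex.mul_conj, Complex.normSq_eq_norm_sq]
  rw [this]
  ring

lemma sum_overlap_mul_left (hA : A.IsHermitian) (hB : B.IsHermitian) (φ : ℝ → ℝ) :
    ∑ i, ∑ j, hA.overlap hB i j * φ (hA.eigenvalues i) = ∑ i, φ (hA.eigenvalues i) := by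
  have h := hA.trace_spectralMap_mul_spectralMap hB φ (fun _ => 1)
  rw [spectralMap_one, mul_one, trace_spectralMap] at h
  have h' := Complex.ofReal_injective h
  simpa using h'.symm

lemma sum_overlap_mul_right (hA : A.IsHermitian) (hB : B.IsHermitian) (ψ : ℝ → ℝ) :
    ∑ i, ∑ j, hA.overlap hB i j * ψ (hB.eigenvalues j) = ∑ j, ψ (hB.eigenvalues j) := by
  have h := hA.trace_spectralMap_mul_spectralMap hB (fun _ => 1) ψ
  rw [spectralMap_one, one_mul, trace_spectralMap] at h
  have h' := Complex.ofReal_injective h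
  simpa using h'.symm

lemma sum_norm_sq_spectralMap (hA : A.IsHermitian) (φ : ℝ → ℝ) :
    ∑ i, ∑ j, ‖hA.spectralMap φ i j‖ ^ 2 = ∑ i, φ (hA.eigenvalues i) ^ 2 := by
  have h := (hA.spectralMap_isHermitian φ).trace_mul_self
  rw [spectralMap_mul, trace_spectralMap] at h
  simpa [sq] using (Complex.ofReal_injective h).symm

/-- An identity behind the Hoffman–Wielandt inequality. -/
lemma sum_overlap_mul_sub_sq (hA : A.IsHermitian) (hB : B.IsHermitian) :
    ∑ i, ∑ j, hA.overlap hB i j * (hA.eigenvalues i - hB.eigenvalues j) ^ 2 =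
      ∑ i, ∑ j, ‖A i j - B i j‖ ^ 2 := by
  have h := (hA.sub hB).trace_mul_self
  have h1 : ((A - B) * (A - B)).trace = (A * A).trace + (B * B).trace - 2 * (A * B).trace := by
    rw [sub_mul, mul_sub, mul_sub, Matrix.trace_sub, Matrix.trace_sub, Matrix.trace_sub,
      Matrix.trace_mul_comm B A]
    ring
  have hAA : (A * A).trace = ((∑ i, hA.eigenvalues i ^ 2 : ℝ) : ℂ) := by
    have := hA.spectralMap_mul (fun x => x) (fun x => x)
    rw [spectralMap_id] at this
    rw [this, trace_spectralMap]; simp [sq]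
  have hBB : (B * B).trace = ((∑ i, hB.eigenvalues i ^ 2 : ℝ) : ℂ) := by
    have := hB.spectralMap_mul (fun x => x) (fun x => x)
    rw [spectralMap_id] at this
    rw [this, trace_spectralMap]; simp [sq]
  have hAB := hA.trace_spectralMap_mul_spectralMap hB (fun x => x) (fun x => x)
  rw [spectralMap_id, spectralMap_id] at hAB
  rw [h1, hAA, hBB, hAB] at h
  have h2 : (∑ i, hA.eigenvalues i ^ 2) + (∑ i, hB.eigenvalues i ^ 2) -
      2 * (∑ i, ∑ j, hA.overlap hB i j * (hA.eigenvalues i * hB.eigenvalues j)) =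
      ∑ i, ∑ j, ‖(A - B) i j‖ ^ 2 := by exact_mod_cast h
  rw [← hA.sum_overlap_mul_left hB (fun x => x ^ 2), ← hA.sum_overlap_mul_right hB (fun x => x ^ 2),
    Finset.mul_sum, ← Finset.sum_add_distrib, ← Finset.sum_sub_distrib] at h2
  simp only [Matrix.sub_apply] at h2
  rw [← h2]
  refine Finset.sum_congr rfl fun i _ => ?_
  rw [Finset.mul_sum, ← Finset.sum_add_distrib, ← Finset.sum_sub_distrib]
  exact Finset.sum_congr rfl fun j _ => by ring

/-- The average over the spectrum of a Lipschitz function is Lipschitz for the Frobenius norm. -/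
lemma abs_sum_eigenvalues_sub_le (hA : A.IsHermitian) (hB : B.IsHermitian) {f : ℝ → ℝ} {K : ℝ}
    (hK : 0 ≤ K) (hf : ∀ x y, |f x - f y| ≤ K * |x - y|) :
    |∑ i, f (hA.eigenvalues i) - ∑ i, f (hB.eigenvalues i)| ≤
      K * √(Fintype.card ι) * √(∑ i, ∑ j, ‖A i j - B i j‖ ^ 2) := by
  set p := hA.overlap hB
  have hp : ∀ i j, 0 ≤ p i j := hA.overlap_nonneg hB
  -- Cauchy–Schwarz for the overlap weights, whose total mass is the dimension.
  have hcs := Real.sum_mul_le_sqrt_mul_sqrt (Finset.univ : Finset (ι × ι))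
    (fun q => √(p q.1 q.2)) (fun q => √(p q.1 q.2) * |hA.eigenvalues q.1 - hB.eigenvalues q.2|)
  simp only [mul_pow, Real.sq_sqrt (hp _ _), sq_abs, ← mul_assoc, Real.mul_self_sqrt (hp _ _),
    Fintype.sum_prod_type] at hcs
  have hcard : ∑ i, ∑ j, p i j = Fintype.card ι := by
    simpa using hA.sum_overlap_mul_left hB (fun _ => 1)
  rw [hcard, hA.sum_overlap_mul_sub_sq hB] at hcs
  rw [← hA.sum_overlap_mul_left hB f, ← hA.sum_overlap_mul_right hB f, ← Finset.sum_sub_distrib,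
    mul_assoc]
  refine le_trans ?_ (mul_le_mul_of_nonneg_left hcs hK)
  rw [Finset.mul_sum]
  refine (Finset.abs_sum_le_sum_abs _ _).trans (Finset.sum_le_sum fun i _ => ?_)
  rw [Finset.mul_sum, ← Finset.sum_sub_distrib]
  refine (Finset.abs_sum_le_sum_abs _ _).trans (Finset.sum_le_sum fun j _ => ?_)
  rw [← mul_sub, abs_mul, abs_of_nonneg (hp i j)]
  calc p i j * |f (hA.eigenvalues i) - f (hB.eigenvalues j)|
      ≤ p i j * (K * |hA.eigenvalues i - hB.eigenvalues j|) :=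
        mul_le_mul_of_nonneg_left (hf _ _) (hp i j)
    _ = _ := by ring

/-- **Klein's inequality**. -/
lemma sum_eigenvalues_sub_le (hA : A.IsHermitian) (hB : B.IsHermitian) {g g' : ℝ → ℝ}
    (hg : ∀ x y, g x + g' x * (y - x) ≤ g y) :
    ∑ i, g (hA.eigenvalues i) - ∑ i, g (hB.eigenvalues i) ≤
      (hA.spectralMap g' * (A - B)).trace.re := by
  have h1 := hA.trace_spectralMap_mul_spectralMap hB g' (fun x => x)
  have h2 := hA.spectralMap_mul g' (fun x => x)
  have h3 := hA.trace_spectralMap (fun x => g' x * x)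
  rw [spectralMap_id] at h1 h2
  rw [← h2] at h3
  rw [mul_sub, Matrix.trace_sub, h3, h1, Complex.sub_re, Complex.ofReal_re, Complex.ofReal_re,
    ← hA.sum_overlap_mul_left hB g, ← hA.sum_overlap_mul_right hB g,
    ← hA.sum_overlap_mul_left hB (fun x => g' x * x), ← Finset.sum_sub_distrib,
    ← Finset.sum_sub_distrib]
  -- All sums now carry the same nonnegative weights; what remains is the scalar subgradient
  -- inequality for each pair of eigenvalues.
  refine Finset.sum_le_sum fun i _ => ?_
  rw [← Finset.sum_sub_distrib, ← Finset.sum_sub_distrib]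
  refine Finset.sum_le_sum fun j _ => ?_
  rw [← mul_sub, ← mul_sub]
  refine mul_le_mul_of_nonneg_left ?_ (hA.overlap_nonneg hB i j)
  linarith [hg (hA.eigenvalues i) (hB.eigenvalues j)]

end Matrix.IsHermitian

/-! ### One-sided Efron–Stein inequality -/

section EfronStein

variable {ι : Type*} [Fintype ι] {E : ι → Type*} [∀ i, MeasurableSpace (E i)]

/-- A product of product measures is the product of the two product measures. -/
lemma MeasureTheory.measurePreserving_piProdEquivProdPi (μ ν : ∀ i, Measure (E i))
    [∀ i, SigmaFinite (μ i)] [∀ i, SigmaFinite (ν i)] :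
    MeasurePreserving (fun (z : ∀ i, E i × E i) => ((fun i => (z i).1), (fun i => (z i).2)))
      (Measure.pi fun i => (μ i).prod (ν i)) ((Measure.pi μ).prod (Measure.pi ν)) where
  measurable := by fun_prop
  map_eq := by
    refine (Measure.prod_eq_generateFrom generateFrom_pi generateFrom_pi isPiSystem_pi
      isPiSystem_pi (Measure.FiniteSpanningSetsIn.pi fun i => (μ i).toFiniteSpanningSetsIn)
      (Measure.FiniteSpanningSetsIn.pi fun i => (ν i).toFiniteSpanningSetsIn) ?_).symm
    rintro _ ⟨s, hs, rfl⟩ _ ⟨t, ht, rfl⟩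
    have hs' : ∀ i, MeasurableSet (s i) := fun i => hs i (Set.mem_univ i)
    have ht' : ∀ i, MeasurableSet (t i) := fun i => ht i (Set.mem_univ i)
    rw [Measure.map_apply (by fun_prop)
      ((MeasurableSet.univ_pi hs').prod (MeasurableSet.univ_pi ht'))]
    rw [show (fun (z : ∀ i, E i × E i) => ((fun i => (z i).1), (fun i => (z i).2))) ⁻¹'
        (Set.univ.pi s ×ˢ Set.univ.pi t) = Set.univ.pi fun i => s i ×ˢ t i by
      ext; simp [Set.mem_pi, forall_and]]
    simp_rw [Measure.pi_pi, Measure.prod_prod, Finset.prod_mul_distrib]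

variable [DecidableEq ι]

/-- Select the second component at indices in `S` and the first one elsewhere. -/
def mixCoords (S : Finset ι) (z : ∀ i, E i × E i) (i : ι) : E i :=
  if i ∈ S then (z i).2 else (z i).1

/-- Swap the two components at the indices in `S`. -/
def swapCoords (S : Finset ι) (z : ∀ i, E i × E i) (i : ι) : E i × E i :=
  if i ∈ S then (z i).swap else z i

lemma measurable_mixCoords {ι : Type*} [DecidableEq ι] {E : ι → Type*}
    [∀ i, MeasurableSpace (E i)] (S : Finset ι) : Measurable (mixCoords (E := E) S) := by
  refine measurable_pi_iff.2 fun i => ?_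
  unfold mixCoords
  split_ifs <;> fun_prop

lemma measurePreserving_swapCoords (S : Finset ι) (μ : ∀ i, Measure (E i))
    [∀ i, IsProbabilityMeasure (μ i)] :
    MeasurePreserving (swapCoords (E := E) S) (Measure.pi fun i => (μ i).prod (μ i))
      (Measure.pi fun i => (μ i).prod (μ i)) := by
  refine measurePreserving_pi (f := fun i (p : E i × E i) => if i ∈ S then p.swap else p) _ _ fun i => ?_
  split_ifs
  · exact Measure.measurePreserving_swap
  · exact MeasurePreserving.id _

lemma mixCoords_swapCoords {ι : Type*} [DecidableEq ι] {E : ι → Type*} (S T : Finset ι) (z : ∀ i, E i × E i) :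
    mixCoords T (swapCoords S z) = mixCoords (symmDiff S T) z := by
  funext i
  by_cases hS : i ∈ S <;> by_cases hT : i ∈ T <;>
    simp [mixCoords, swapCoords, hS, hT, Finset.mem_symmDiff]

/-- The correlations of `F` between two partially resampled points. -/
noncomputable def mixCorr (μ : ∀ i, Measure (E i)) (F : (∀ i, E i) → ℝ) (S T : Finset ι) : ℝ :=
  ∫ z, F (mixCoords S z) * F (mixCoords T z) ∂(Measure.pi fun i => (μ i).prod (μ i))

variable {μ : ∀ i, Measure (E i)} [∀ i, IsProbabilityMeasure (μ i)] {F : (∀ i, E i) → ℝ} {C : ℝ}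

lemma integrable_mixCoords_mul (hF : Measurable F) (hC : ∀ x, |F x| ≤ C) (S T : Finset ι) :
    Integrable (fun z => F (mixCoords S z) * F (mixCoords T z))
      (Measure.pi fun i => (μ i).prod (μ i)) := by
  refine Integrable.of_bound (C := C * C) ?_ (Eventually.of_forall fun z => ?_)
  · exact ((hF.comp (measurable_mixCoords S)).mul
      (hF.comp (measurable_mixCoords T))).aestronglyMeasurable
  · rw [Real.norm_eq_abs, abs_mul]
    exact mul_le_mul (hC _) (hC _) (abs_nonneg _) ((abs_nonneg _).trans (hC (mixCoords S z)))

lemma measurable_sq_max_mixCoords {ι : Type*} [DecidableEq ι] {E : ι → Type*}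
    [∀ i, MeasurableSpace (E i)] {F : (∀ i, E i) → ℝ} (hF : Measurable F) (S T : Finset ι) :
    Measurable fun z : ∀ i, E i × E i => max (F (mixCoords S z) - F (mixCoords T z)) 0 ^ 2 :=
  (((hF.comp (measurable_mixCoords S)).sub (hF.comp (measurable_mixCoords T))).max
    measurable_const).pow_const 2

lemma integrable_sq_max_mixCoords (hF : Measurable F) (hC : ∀ x, |F x| ≤ C) (S T : Finset ι) :
    Integrable (fun z => max (F (mixCoords S z) - F (mixCoords T z)) 0 ^ 2)
      (Measure.pi fun i => (μ i).prod (μ i)) := by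
  refine Integrable.of_bound (C := (2 * C) ^ 2)
    (measurable_sq_max_mixCoords hF S T).aestronglyMeasurable (Eventually.of_forall fun z => ?_)
  rw [Real.norm_eq_abs, abs_of_nonneg (sq_nonneg _)]
  have h1 := abs_le.1 (hC (mixCoords S z))
  have h2 := abs_le.1 (hC (mixCoords T z))
  exact pow_le_pow_left₀ (le_max_right _ _) (max_le (by linarith) (by linarith)) 2

/-- Swapping the two i.i.d. copies at the indices in `U` preserves the measure. Hence the
correlation depends only on the symmetric difference of `S` and `T`. -/
lemma mixCorr_symmDiff (hF : Measurable F) (U S T : Finset ι) :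
    mixCorr μ F (symmDiff U S) (symmDiff U T) = mixCorr μ F S T := by
  have h := measurePreserving_swapCoords U μ
  have hm : AEStronglyMeasurable (fun z => F (mixCoords S z) * F (mixCoords T z))
      (Measure.map (swapCoords (E := E) U) (Measure.pi fun i => (μ i).prod (μ i))) :=
    ((hF.comp (measurable_mixCoords S)).mul
      (hF.comp (measurable_mixCoords T))).aestronglyMeasurable
  have h' := integral_map h.measurable.aemeasurable hm
  rw [h.map_eq] at h'
  simp only [mixCoords_swapCoords] at h'
  exact h'.symm

/-- Expand the expected square of the mixed second difference of `F` in the directions `{a}` and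
`S`. By swap invariance every term is a correlation with `∅`, and nonnegativity is four times the
claim. -/
lemma mixCorr_sub_insert_le (hF : Measurable F) (hC : ∀ x, |F x| ≤ C) {S : Finset ι} {a : ι}
    (ha : a ∉ S) :
    mixCorr μ F ∅ S - mixCorr μ F ∅ (insert a S) ≤ mixCorr μ F ∅ ∅ - mixCorr μ F ∅ {a} := by
  have hI := integrable_mixCoords_mul (μ := μ) hF hC
  have h0 : 0 ≤ ∫ z, (F (mixCoords ∅ z) - F (mixCoords {a} z) - F (mixCoords S z) +
      F (mixCoords (insert a S) z)) ^ 2 ∂(Measure.pi fun i => (μ i).prod (μ i)) :=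
    integral_nonneg fun z => sq_nonneg _
  have hexp : ∀ z, (F (mixCoords ∅ z) - F (mixCoords {a} z) - F (mixCoords S z) +
      F (mixCoords (insert a S) z)) ^ 2 =
      F (mixCoords ∅ z) * F (mixCoords ∅ z) + F (mixCoords {a} z) * F (mixCoords {a} z) +
      F (mixCoords S z) * F (mixCoords S z) +
      F (mixCoords (insert a S) z) * F (mixCoords (insert a S) z) +
      2 * (F (mixCoords ∅ z) * F (mixCoords (insert a S) z) +
        F (mixCoords {a} z) * F (mixCoords S z)) -
      2 * (F (mixCoords ∅ z) * F (mixCoords {a} z) + F (mixCoords ∅ z) * F (mixCoords S z) +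
        F (mixCoords {a} z) * F (mixCoords (insert a S) z) +
        F (mixCoords S z) * F (mixCoords (insert a S) z)) := fun z => by ring
  simp_rw [hexp] at h0
  rw [integral_sub, integral_add, integral_add, integral_add, integral_add, integral_const_mul,
    integral_const_mul, integral_add, integral_add, integral_add, integral_add] at h0
  · have e1 := mixCorr_symmDiff (μ := μ) hF {a} {a} {a}
    have e2 := mixCorr_symmDiff (μ := μ) hF S S S
    have e3 := mixCorr_symmDiff (μ := μ) hF (insert a S) (insert a S) (insert a S)
    have e4 := mixCorr_symmDiff (μ := μ) hF {a} {a} S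
    have e5 := mixCorr_symmDiff (μ := μ) hF {a} {a} (insert a S)
    have e6 := mixCorr_symmDiff (μ := μ) hF S S (insert a S)
    have s1 : symmDiff {a} S = insert a S := by ext i; simp [Finset.mem_symmDiff]; grind
    have s2 : symmDiff {a} (insert a S) = S := by ext i; simp [Finset.mem_symmDiff]; grind
    have s3 : symmDiff S (insert a S) = {a} := by ext i; simp [Finset.mem_symmDiff]; grind
    simp only [symmDiff_self, Finset.bot_eq_empty, s1, s2, s3] at e1 e2 e3 e4 e5 e6
    simp only [mixCorr] at *
    linarith
  all_goals repeat' first | exact hI _ _ | apply Integrable.add | apply Integrable.const_mul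

lemma mixCorr_sub_le_sum (hF : Measurable F) (hC : ∀ x, |F x| ≤ C) (S : Finset ι) :
    mixCorr μ F ∅ ∅ - mixCorr μ F ∅ S ≤ ∑ i ∈ S, (mixCorr μ F ∅ ∅ - mixCorr μ F ∅ {i}) := by
  induction S using Finset.induction_on with
  | empty => simp
  | insert a S ha ih =>
    rw [Finset.sum_insert ha]
    linarith [mixCorr_sub_insert_le (μ := μ) hF hC ha]

/-- The left side is half the mean square of the difference. Swapping the copies at `a` changes its
sign, so positive and negative parts contribute equally. -/
lemma mixCorr_empty_singleton (hF : Measurable F) (hC : ∀ x, |F x| ≤ C) (a : ι) :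
    mixCorr μ F ∅ ∅ - mixCorr μ F ∅ {a} =
      ∫ z, max (F (mixCoords ∅ z) - F (mixCoords {a} z)) 0 ^ 2
        ∂(Measure.pi fun i => (μ i).prod (μ i)) := by
  have hI := integrable_mixCoords_mul (μ := μ) hF hC
  have hb := integrable_sq_max_mixCoords (μ := μ) hF hC
  have h := measurePreserving_swapCoords {a} μ
  have h' := integral_map (μ := Measure.pi fun i => (μ i).prod (μ i)) h.measurable.aemeasurable
    (measurable_sq_max_mixCoords hF ∅ {a}).aestronglyMeasurable
  rw [h.map_eq] at h'
  simp only [mixCoords_swapCoords, symmDiff_self, Finset.bot_eq_empty] at h'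
  rw [show symmDiff {a} (∅ : Finset ι) = {a} from symmDiff_bot _] at h'
  have h2 : ∫ z, (F (mixCoords ∅ z) * F (mixCoords ∅ z) +
      F (mixCoords {a} z) * F (mixCoords {a} z) - 2 * (F (mixCoords ∅ z) * F (mixCoords {a} z)))
      ∂(Measure.pi fun i => (μ i).prod (μ i)) =
      ∫ z, (max (F (mixCoords ∅ z) - F (mixCoords {a} z)) 0 ^ 2 +
        max (F (mixCoords {a} z) - F (mixCoords ∅ z)) 0 ^ 2)
        ∂(Measure.pi fun i => (μ i).prod (μ i)) := by
    refine integral_congr_ae (Eventually.of_forall fun z => ?_)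
    rcases le_total (F (mixCoords ∅ z)) (F (mixCoords {a} z)) with hle | hle
    · simp only [max_eq_right (sub_nonpos.2 hle), max_eq_left (sub_nonneg.2 hle)]; ring
    · simp only [max_eq_right (sub_nonpos.2 hle), max_eq_left (sub_nonneg.2 hle)]; ring
  have hI2 : Integrable (fun z => F (mixCoords ∅ z) * F (mixCoords ∅ z) +
      F (mixCoords {a} z) * F (mixCoords {a} z)) (Measure.pi fun i => (μ i).prod (μ i)) :=
    (hI _ _).add (hI _ _)
  rw [integral_sub hI2 ((hI _ _).const_mul 2), integral_add (hI _ _) (hI _ _),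
    integral_const_mul, integral_add (hb _ _) (hb _ _), ← h'] at h2
  have e1 := mixCorr_symmDiff (μ := μ) hF {a} {a} {a}
  simp only [symmDiff_self, Finset.bot_eq_empty] at e1
  simp only [mixCorr] at *
  linarith

/-- The **Efron–Stein inequality** in its one-sided form: if the sum of the squared decreases of
`F` under resampling a single coordinate is at most `V` then the variance of `F` is at most `V`. -/
theorem integral_sq_sub_sq_integral_pi_le (hF : Measurable F) (hC : ∀ x, |F x| ≤ C) {V : ℝ}
    (hV : ∀ x y : ∀ i, E i, ∑ i, max (F x - F (Function.update x i (y i))) 0 ^ 2 ≤ V) :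
    ∫ x, F x ^ 2 ∂(Measure.pi μ) - (∫ x, F x ∂(Measure.pi μ)) ^ 2 ≤ V := by
  have hprod := measurePreserving_piProdEquivProdPi μ μ
  have hempty : ∀ z : ∀ i, E i × E i, mixCoords ∅ z = fun i => (z i).1 := fun z => by
    funext i; simp [mixCoords]
  have huniv : ∀ z : ∀ i, E i × E i, mixCoords Finset.univ z = fun i => (z i).2 := fun z => by
    funext i; simp [mixCoords]
  have hsing : ∀ (z : ∀ i, E i × E i) (a : ι),
      mixCoords {a} z = Function.update (fun i => (z i).1) a (z a).2 := fun z a => by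
    funext i
    by_cases h : i = a
    · subst h; simp [mixCoords]
    · simp [mixCoords, h]
  have e1 : mixCorr μ F ∅ ∅ = ∫ x, F x ^ 2 ∂(Measure.pi μ) := by
    have h := measurePreserving_pi (fun i => (μ i).prod (μ i)) μ
      (fun i => measurePreserving_fst (μ := μ i) (ν := μ i))
    have h' := integral_map (μ := Measure.pi fun i => (μ i).prod (μ i)) (f := fun x => F x ^ 2) h.measurable.aemeasurable
      (hF.pow_const 2).aestronglyMeasurable
    rw [h.map_eq] at h'
    rw [h', mixCorr]
    simp only [hempty, sq]
  have e2 : mixCorr μ F ∅ Finset.univ = (∫ x, F x ∂(Measure.pi μ)) ^ 2 := by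
    have hm : Measurable fun p : (∀ i, E i) × (∀ i, E i) => F p.1 * F p.2 :=
      (hF.comp measurable_fst).mul (hF.comp measurable_snd)
    have h' := integral_map (μ := Measure.pi fun i => (μ i).prod (μ i))
      (f := fun p : (∀ i, E i) × (∀ i, E i) => F p.1 * F p.2)
      hprod.measurable.aemeasurable hm.aestronglyMeasurable
    rw [hprod.map_eq, integral_prod_mul] at h'
    rw [sq, h', mixCorr]
    simp only [hempty, huniv]
  -- The variance is the total drop of the correlation with `∅` as the resampled set grows from `∅`
  -- to everything.
  rw [← e1, ← e2]
  refine (mixCorr_sub_le_sum hF hC Finset.univ).trans ?_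
  simp only [mixCorr_empty_singleton hF hC]
  have hb := fun a => integrable_sq_max_mixCoords (μ := μ) hF hC ∅ {a}
  rw [← integral_finsetSum _ fun a _ => hb a]
  refine (integral_mono (integrable_finsetSum _ fun a _ => hb a) (integrable_const V)
    fun z => ?_).trans_eq (by simp)
  simp only [hempty, hsing]
  exact hV (fun i => (z i).1) (fun i => (z i).2)

end EfronStein

/-! ### Approximation by differences of convex functions -/

section ConvexApproximation

lemma add_mul_sub_le_of_monotone_deriv {g g' : ℝ → ℝ} (hg : ∀ x, HasDerivAt g (g' x) x)
    (hmono : Monotone g') (x y : ℝ) : g x + g' x * (y - x) ≤ g y := by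
  have hconv : ConvexOn ℝ Set.univ g := by
    refine Monotone.convexOn_univ_of_deriv (fun x => (hg x).differentiableAt) ?_
    rwa [funext fun x => (hg x).deriv]
  rcases lt_trichotomy x y with h | rfl | h
  · have := hconv.le_slope_of_hasDerivAt (Set.mem_univ x) (Set.mem_univ y) h (hg x)
    rw [slope_def_field, le_div_iff₀ (sub_pos.2 h)] at this
    linarith
  · simp
  · have := hconv.slope_le_of_hasDerivAt (Set.mem_univ y) (Set.mem_univ x) h (hg x)
    rw [slope_def_field, div_le_iff₀ (sub_pos.2 h)] at this
    linarith

/-- A compactly supported Lipschitz function is a uniform limit of differences of convex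
functions with bounded subgradients. -/
lemma exists_convex_sub_convex_approx {f : ℝ → ℝ} (hfc : HasCompactSupport f)
    (hfL : LipschitzWith 1 f) {δ : ℝ} (hδ : 0 < δ) :
    ∃ (K : ℝ) (g g' h h' : ℝ → ℝ), 0 ≤ K ∧ (∀ x, |f x - (g x - h x)| ≤ δ) ∧
      (∀ x y, g x + g' x * (y - x) ≤ g y) ∧ (∀ x, |g' x| ≤ K) ∧
      (∀ x y, h x + h' x * (y - x) ≤ h y) ∧ (∀ x, |h' x| ≤ K) := by
  have hL : ∀ x y, |f x - f y| ≤ |x - y| := fun x y => by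
    simpa [Real.dist_eq] using hfL.dist_le_mul x y
  obtain ⟨R, hR⟩ := hfc.isCompact.isBounded.subset_closedBall 0
  have hR0 : ∀ x, R < |x| → f x = 0 := fun x hx => by
    by_contra h
    have := hR (subset_tsupport f h)
    rw [Metric.mem_closedBall, Real.dist_eq, sub_zero] at this
    linarith
  -- Large enough that `f x` and `f (x + δ)` both vanish when `M ≤ |x|`.
  set M : ℝ := |R| + δ + 1 with hM
  have hRM : R ≤ |R| := le_abs_self R
  have hR' := abs_nonneg R
  have hM0 : 0 < M := by positivity
  set u : ℝ → ℝ := fun x => (f (x + δ) - f x) / δ with hu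
  set c : ℝ → ℝ := fun x => max (-M) (min M x) with hc
  have hcM : ∀ x, |c x| ≤ M := fun x =>
    abs_le.2 ⟨le_max_left _ _, max_le (by linarith) (min_le_left _ _)⟩
  have hu0 : ∀ x, M ≤ |x| → u x = 0 := fun x hx => by
    have h1 : f x = 0 := hR0 x (by linarith)
    have h2 : f (x + δ) = 0 := hR0 _ (by
      have := abs_sub_abs_le_abs_sub x (-δ)
      rw [abs_neg, abs_of_pos hδ, sub_neg_eq_add] at this
      linarith)
    simp [hu, h1, h2]
  have huc : ∀ x, u (c x) = u x := fun x => by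
    rcases le_total x (-M) with h | h
    · have : c x = -M := max_eq_left ((min_le_right _ _).trans h)
      rw [this, hu0 _ (by rw [abs_neg, abs_of_pos hM0]),
        hu0 x (by rw [abs_of_nonpos (by linarith)]; linarith)]
    rcases le_total M x with h' | h'
    · have : c x = M := by simp only [hc, min_eq_left h']; exact max_eq_right (by linarith)
      rw [this, hu0 _ (by rw [abs_of_pos hM0]), hu0 x (by rw [abs_of_nonneg (by linarith)]; exact h')]
    · have : c x = x := by simp only [hc, min_eq_right h']; exact max_eq_right h
      rw [this]
  have hcmono : Monotone c := fun x y hxy => max_le_max le_rfl (min_le_min le_rfl hxy)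
  have hcc : Continuous c := by fun_prop
  -- The moving average `v` of `f` over `[x, x + δ]` has derivative `u`, which is `2/δ`-Lipschitz
  -- and vanishes off `[-M, M]`. Adding slope `2/δ` on that interval makes the derivative monotone,
  -- and clamping keeps it bounded.
  set h' : ℝ → ℝ := fun x => 2 / δ * c x with hh'
  set h : ℝ → ℝ := fun x => ∫ t in (0 : ℝ)..x, h' t with hh
  have hh'c : Continuous h' := by fun_prop
  have hhd : ∀ x, HasDerivAt h (h' x) x := fun x => hh'c.integral_hasStrictDerivAt 0 x |>.hasDerivAt
  have hh'mono : Monotone h' := fun x y hxy =>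
    mul_le_mul_of_nonneg_left (hcmono hxy) (by positivity)
  set Φ : ℝ → ℝ := fun x => ∫ t in (0 : ℝ)..x, f t with hΦ
  have hΦd : ∀ x, HasDerivAt Φ (f x) x := fun x =>
    (hfL.continuous.integral_hasStrictDerivAt 0 x).hasDerivAt
  set v : ℝ → ℝ := fun x => (Φ (x + δ) - Φ x) / δ with hv
  have hvd : ∀ x, HasDerivAt v (u x) x := fun x => by
    have h1 := (hΦd (x + δ)).comp_add_const x δ
    exact (h1.sub (hΦd x)).div_const δ
  have hub : ∀ x, |u x| ≤ 1 := fun x => by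
    rw [hu]
    simp only [abs_div, abs_of_pos hδ]
    rw [div_le_one hδ]
    exact (hL _ _).trans (by simp [abs_of_pos hδ])
  have hh'b : ∀ x, |h' x| ≤ 2 / δ * M := fun x => by
    rw [hh', abs_mul, abs_of_pos (by positivity : 0 < 2 / δ)]
    exact mul_le_mul_of_nonneg_left (hcM x) (by positivity)
  refine ⟨1 + 2 / δ * M, fun x => v x + h x, fun x => u x + h' x, h, h', by positivity, fun x => ?_,
    add_mul_sub_le_of_monotone_deriv (fun x => (hvd x).add (hhd x)) fun x y hxy => ?_,
    fun x => (abs_add_le _ _).trans (add_le_add (hub x) (hh'b x)),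
    add_mul_sub_le_of_monotone_deriv hhd hh'mono, fun x => (hh'b x).trans (by linarith)⟩
  · obtain ⟨ξ, hξ, hξe⟩ := exists_hasDerivAt_eq_slope Φ f (lt_add_of_pos_right x hδ)
      (fun y _ => (hΦd y).continuousAt.continuousWithinAt) (fun y _ => hΦd y)
    have : v x = f ξ := by rw [hξe, hv]; simp
    rw [add_sub_cancel_right, this]
    refine (hL _ _).trans (abs_le.2 ⟨?_, ?_⟩) <;> linarith [hξ.1, hξ.2]
  · have h1 := hcmono hxy
    have h2 := abs_le.1 (hL (c x + δ) (c y + δ))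
    have h3 := abs_le.1 (hL (c x) (c y))
    rw [show c x + δ - (c y + δ) = c x - c y by ring] at h2
    rw [abs_of_nonpos (by linarith : c x - c y ≤ 0)] at h2 h3
    rw [← huc x, ← huc y]
    simp only [hu, hh']
    rw [div_add' _ _ _ hδ.ne', div_add' _ _ _ hδ.ne']
    refine div_le_div_of_nonneg_right ?_ hδ.le
    have e : ∀ z, 2 / δ * c z * δ = 2 * c z := fun z => by field_simp
    rw [e, e]
    linarith [h2.1, h2.2, h3.1, h3.2]

end ConvexApproximation

/-! ### Variance bound from subgradients and independent blocks -/

section Subgradient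

variable {ι : Type*} [Fintype ι]

/-- `F` is bounded from below by affine functions touching it at any prescribed point, whose
linear parts have Euclidean norm at most `L`. -/
def HasSubgradients (F : (ι → ℂ) → ℝ) (L : ℝ) : Prop :=
  ∀ x, ∃ G : ι → ℂ, ∑ q, ‖G q‖ ^ 2 ≤ L ^ 2 ∧ ∀ y, F x - F y ≤ ∑ q, (G q * (x q - y q)).re

lemma HasSubgradients.sub_le {F : (ι → ℂ) → ℝ} {L : ℝ} (hF : HasSubgradients F L) (hL : 0 ≤ L)
    (x y : ι → ℂ) : F x - F y ≤ L * √(∑ q, ‖x q - y q‖ ^ 2) := by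
  obtain ⟨G, hG, h⟩ := hF x
  refine (h y).trans ?_
  calc ∑ q, (G q * (x q - y q)).re ≤ ∑ q, ‖G q‖ * ‖x q - y q‖ :=
        Finset.sum_le_sum fun q _ => (Complex.re_le_norm _).trans_eq (norm_mul _ _)
    _ ≤ √(∑ q, ‖G q‖ ^ 2) * √(∑ q, ‖x q - y q‖ ^ 2) := Real.sum_mul_le_sqrt_mul_sqrt _ _ _
    _ ≤ L * √(∑ q, ‖x q - y q‖ ^ 2) := by
        refine mul_le_mul_of_nonneg_right ?_ (Real.sqrt_nonneg _)
        exact (Real.sqrt_le_sqrt hG).trans_eq (Real.sqrt_sq hL)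

/-- Supplies the measurability of spectral statistics as functions of the entries. -/
lemma continuous_of_abs_sub_le_sqrt {F : (ι → ℂ) → ℝ} {L : ℝ}
    (h : ∀ x y, |F x - F y| ≤ L * √(∑ q, ‖x q - y q‖ ^ 2)) : Continuous F := by
  refine continuous_iff_continuousAt.2 fun y => ?_
  rw [ContinuousAt, tendsto_iff_dist_tendsto_zero]
  refine squeeze_zero (fun _ => dist_nonneg) (fun x => h x y) ?_
  have : Continuous fun x : ι → ℂ => L * √(∑ q, ‖x q - y q‖ ^ 2) := by fun_prop
  simpa using this.tendsto y

lemma HasSubgradients.abs_sub_le {F : (ι → ℂ) → ℝ} {L : ℝ} (hF : HasSubgradients F L)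
    (hL : 0 ≤ L) (x y : ι → ℂ) : |F x - F y| ≤ L * √(∑ q, ‖x q - y q‖ ^ 2) := by
  refine abs_sub_le_iff.2 ⟨hF.sub_le hL x y, ?_⟩
  simpa only [norm_sub_rev] using hF.sub_le hL y x

/-- The vector `x` with the entries of modulus larger than `t` replaced by zero. -/
noncomputable def truncEntries (t : ℝ) (x : ι → ℂ) (q : ι) : ℂ := if ‖x q‖ ≤ t then x q else 0

lemma norm_truncEntries_le {ι : Type*} {t : ℝ} (ht : 0 ≤ t) (x : ι → ℂ) (q : ι) :
    ‖truncEntries t x q‖ ≤ t := by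
  unfold truncEntries
  split_ifs with h
  · exact h
  · simpa using ht

lemma measurable_truncEntries {ι : Type*} (t : ℝ) : Measurable (truncEntries (ι := ι) t) := by
  refine measurable_pi_iff.2 fun q => ?_
  exact Measurable.ite (measurableSet_le (by fun_prop) measurable_const) (by fun_prop)
    measurable_const

lemma HasSubgradients.abs_truncEntries_le {F : (ι → ℂ) → ℝ} {L : ℝ} (hF : HasSubgradients F L)
    (hL : 0 ≤ L) {t : ℝ} (ht : 0 ≤ t) (x : ι → ℂ) :
    |F (truncEntries t x)| ≤ |F 0| + L * √(∑ _q : ι, t ^ 2) := by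
  have h1 := hF.abs_sub_le hL (truncEntries t x) 0
  have h2 : √(∑ q, ‖truncEntries t x q - (0 : ι → ℂ) q‖ ^ 2) ≤ √(∑ _q : ι, t ^ 2) := by
    refine Real.sqrt_le_sqrt (Finset.sum_le_sum fun q _ => ?_)
    rw [Pi.zero_apply, sub_zero]
    exact pow_le_pow_left₀ (norm_nonneg _) (norm_truncEntries_le ht x q) 2
  have h3 := mul_le_mul_of_nonneg_left h2 hL
  have h4 := abs_sub_abs_le_abs_sub (F (truncEntries t x)) (F 0)
  linarith

variable [DecidableEq ι]

/-- Assemble a vector from its restrictions to the parts of a partition. -/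
def glueParts (Q : Finpartition (Finset.univ : Finset ι)) (w : ∀ p : Q.parts, p.1 → ℂ) (q : ι) :
    ℂ :=
  w ⟨Q.part q, Q.part_mem.2 (Finset.mem_univ q)⟩ ⟨q, Q.mem_part (Finset.mem_univ q)⟩

lemma measurable_glueParts (Q : Finpartition (Finset.univ : Finset ι)) :
    Measurable (glueParts Q) := by
  unfold glueParts
  fun_prop

lemma glueParts_update_of_notMem (Q : Finpartition (Finset.univ : Finset ι))
    (w : ∀ p : Q.parts, p.1 → ℂ) (p : Q.parts) (v : p.1 → ℂ) {q : ι} (hq : q ∉ p.1) :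
    glueParts Q (Function.update w p v) q = glueParts Q w q := by
  unfold glueParts
  rw [Function.update_of_ne]
  rintro rfl
  exact hq (Q.mem_part (Finset.mem_univ q))

/-- A function with subgradients of norm at most `L` of a random vector with entries bounded by
`t`, consisting of independent blocks of size at most `d`, has variance at most `4 L² t² d`. -/
theorem HasSubgradients.variance_le {F : (ι → ℂ) → ℝ} {L : ℝ} (hF : HasSubgradients F L)
    (hL : 0 ≤ L) {t : ℝ} (ht : 0 ≤ t) {Ω : Type*} [MeasurableSpace Ω] {P : Measure Ω}
    [IsProbabilityMeasure P] {X : Ω → ι → ℂ} (hX : Measurable X)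
    (Q : Finpartition (Finset.univ : Finset ι))
    (hind : iIndepFun (fun (p : Q.parts) (ω : Ω) (q : p.1) => X ω q) P) {d : ℝ}
    (hd0 : 0 ≤ d) (hd : ∀ p ∈ Q.parts, (p.card : ℝ) ≤ d) :
    ∫ ω, F (truncEntries t (X ω)) ^ 2 ∂P - (∫ ω, F (truncEntries t (X ω)) ∂P) ^ 2 ≤
      4 * L ^ 2 * t ^ 2 * d := by
  have hFm : Measurable F := (continuous_of_abs_sub_le_sqrt (hF.abs_sub_le hL)).measurable
  set H : (∀ p : Q.parts, p.1 → ℂ) → ℝ := fun w => F (truncEntries t (glueParts Q w)) with hH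
  have hHm : Measurable H :=
    hFm.comp ((measurable_truncEntries t).comp (measurable_glueParts Q))
  have hblock : ∀ p : Q.parts, Measurable fun ω (q : p.1) => X ω q := fun p => by fun_prop
  have hmeas : Measurable fun ω (p : Q.parts) (q : p.1) => X ω q := by fun_prop
  have hlaw := (iIndepFun_iff_map_fun_eq_pi_map fun p => (hblock p).aemeasurable).1 hind
  have : ∀ p : Q.parts, IsProbabilityMeasure (P.map fun ω (q : p.1) => X ω q) := fun p =>
    Measure.isProbabilityMeasure_map (hblock p).aemeasurable
  have hmain := integral_sq_sub_sq_integral_pi_le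
    (μ := fun p : Q.parts => P.map fun ω (q : p.1) => X ω q) hHm
    (fun w => hF.abs_truncEntries_le hL ht (glueParts Q w)) (V := 4 * L ^ 2 * t ^ 2 * d) ?_
  · rw [← hlaw, integral_map hmeas.aemeasurable hHm.aestronglyMeasurable,
      integral_map hmeas.aemeasurable (hHm.pow_const 2).aestronglyMeasurable] at hmain
    exact hmain
  intro x y
  obtain ⟨G, hG, hsub⟩ := hF (truncEntries t (glueParts Q x))
  -- The subgradient `G` is taken at the unresampled point, so it is the same for every block. Only
  -- entries in `p` move, each by at most `2 t`; Cauchy–Schwarz over the block costs its size.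
  have hterm : ∀ p : Q.parts, max (H x - H (Function.update x p (y p))) 0 ^ 2 ≤
      4 * t ^ 2 * d * ∑ q ∈ p.1, ‖G q‖ ^ 2 := fun p => by
    have h1 : H x - H (Function.update x p (y p)) ≤ ∑ q ∈ p.1, ‖G q‖ * (2 * t) := by
      refine (hsub _).trans ?_
      rw [← Finset.sum_subset (Finset.subset_univ p.1) fun q _ hq => ?_]
      · refine Finset.sum_le_sum fun q _ => (Complex.re_le_norm _).trans ?_
        rw [norm_mul]
        refine mul_le_mul_of_nonneg_left ((norm_sub_le _ _).trans ?_) (norm_nonneg _)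
        linarith [norm_truncEntries_le ht (glueParts Q x) q,
          norm_truncEntries_le ht (glueParts Q (Function.update x p (y p))) q]
      · simp only [truncEntries, glueParts_update_of_notMem Q x p (y p) hq, sub_self, mul_zero,
          Complex.zero_re]
    have h2 : 0 ≤ ∑ q ∈ p.1, ‖G q‖ * (2 * t) := Finset.sum_nonneg fun q _ => by positivity
    refine (pow_le_pow_left₀ (le_max_right _ _) (max_le h1 h2) 2).trans ?_
    rw [← Finset.sum_mul, mul_pow]
    have h3 := sq_sum_le_card_mul_sum_sq (s := p.1) (f := fun q => ‖G q‖)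
    have h4 := mul_le_mul_of_nonneg_right (hd p.1 p.2)
      (Finset.sum_nonneg fun q _ => sq_nonneg ‖G q‖ : 0 ≤ ∑ q ∈ p.1, ‖G q‖ ^ 2)
    nlinarith [sq_nonneg t]
  refine (Finset.sum_le_sum fun p _ => hterm p).trans ?_
  rw [← Finset.mul_sum, Finset.sum_coe_sort Q.parts fun p => ∑ q ∈ p, ‖G q‖ ^ 2]
  have hsum : ∑ p ∈ Q.parts, ∑ q ∈ p, ‖G q‖ ^ 2 = ∑ q, ‖G q‖ ^ 2 := by
    conv_rhs => rw [← Q.biUnion_parts]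
    exact (Finset.sum_biUnion Q.disjoint).symm
  rw [hsum]
  calc 4 * t ^ 2 * d * ∑ q, ‖G q‖ ^ 2 ≤ 4 * t ^ 2 * d * L ^ 2 :=
        mul_le_mul_of_nonneg_left hG (by positivity)
    _ = _ := by ring

end Subgradient

/-! ### Linear spectral statistics as functions of the entries -/

section LinearStatistics

/-- The Hermitian part of the `n × n` matrix with entries `x`, divided by `√n`. -/
noncomputable def scaledHermPart {n : ℕ} (x : Fin n × Fin n → ℂ) : Matrix (Fin n) (Fin n) ℂ :=
  Matrix.of fun i j => ((1 / √(n : ℝ) : ℝ) : ℂ) * ((x (i, j) + star (x (j, i))) / 2)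

lemma scaledHermPart_isHermitian {n : ℕ} (x : Fin n × Fin n → ℂ) :
    (scaledHermPart x).IsHermitian := by
  ext i j
  simp [scaledHermPart, add_comm]

/-- The average of `f` over the spectrum of the scaled Hermitian part. -/
noncomputable def linStat {n : ℕ} (f : ℝ → ℝ) (x : Fin n × Fin n → ℂ) : ℝ :=
  (n : ℝ)⁻¹ * ∑ i, f ((scaledHermPart_isHermitian x).eigenvalues i)

/-- A Hermitian matrix equals its Hermitian part. Passing to the latter extends the statistic to all
vectors of entries, which is needed because resampling a block may break the symmetry. -/
lemma integral_empSpecDist {n : ℕ} (f : ℝ → ℝ) (A : HermMat n) :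
    ∫ x, f x ∂(empSpecDist ((1 / √(n : ℝ)) • A)) =
      linStat f fun q => (A : Matrix (Fin n) (Fin n) ℂ) q.1 q.2 := by
  have hA : (((1 / √(n : ℝ)) • A : HermMat n) : Matrix (Fin n) (Fin n) ℂ) =
      scaledHermPart fun q => (A : Matrix (Fin n) (Fin n) ℂ) q.1 q.2 := by
    have hh := Matrix.isHermitian_iff_isSelfAdjoint.mpr A.2
    ext i j
    have : star ((A : Matrix (Fin n) (Fin n) ℂ) j i) = (A : Matrix (Fin n) (Fin n) ℂ) i j :=
      hh.apply i j
    simp only [scaledHermPart, Matrix.of_apply, this, selfAdjoint.val_smul, Matrix.smul_apply,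
      Complex.real_smul]
    ring
  unfold empSpecDist linStat
  rw [integral_smul_measure, integral_finsetSum_measure fun i _ => integrable_dirac (by simp)]
  simp only [integral_dirac, smul_eq_mul, ENNReal.toReal_inv, ENNReal.toReal_natCast]
  congr 1
  refine Finset.sum_congr rfl fun i _ => ?_
  congr 2

lemma scaledHermPart_sub_apply {n : ℕ} (x y : Fin n × Fin n → ℂ) (i j : Fin n) :
    scaledHermPart x i j - scaledHermPart y i j = ((1 / √(n : ℝ) : ℝ) : ℂ) *
      (((x (i, j) - y (i, j)) + star (x (j, i) - y (j, i))) / 2) := by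
  simp only [scaledHermPart, Matrix.of_apply, star_sub]
  ring

lemma sum_norm_sq_scaledHermPart_sub_le {n : ℕ} (x y : Fin n × Fin n → ℂ) :
    ∑ i, ∑ j, ‖scaledHermPart x i j - scaledHermPart y i j‖ ^ 2 ≤
      (n : ℝ)⁻¹ * ∑ q, ‖x q - y q‖ ^ 2 := by
  have hc : (1 / √(n : ℝ)) ^ 2 = (n : ℝ)⁻¹ := by
    rw [div_pow, Real.sq_sqrt (Nat.cast_nonneg n), one_pow, one_div]
  have h : ∀ i j, ‖scaledHermPart x i j - scaledHermPart y i j‖ ^ 2 ≤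
      (n : ℝ)⁻¹ * ((‖x (i, j) - y (i, j)‖ ^ 2 + ‖x (j, i) - y (j, i)‖ ^ 2) / 2) := fun i j => by
    rw [scaledHermPart_sub_apply, norm_mul, mul_pow, Complex.norm_real, Real.norm_eq_abs, sq_abs,
      hc]
    refine mul_le_mul_of_nonneg_left ?_ (by positivity)
    rw [norm_div, div_pow]
    have h1 := norm_add_le (x (i, j) - y (i, j)) (star (x (j, i) - y (j, i)))
    rw [norm_star] at h1
    have h2 := pow_le_pow_left₀ (norm_nonneg _) h1 2
    simp only [Complex.norm_ofNat]
    nlinarith [sq_nonneg (‖x (i, j) - y (i, j)‖ - ‖x (j, i) - y (j, i)‖)]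
  refine (Finset.sum_le_sum fun i _ => Finset.sum_le_sum fun j _ => h i j).trans_eq ?_
  simp_rw [← Finset.mul_sum, ← Finset.sum_div, Finset.sum_add_distrib]
  rw [Finset.sum_comm (f := fun i j => ‖x (j, i) - y (j, i)‖ ^ 2), ← Fintype.sum_prod_type',
    add_self_div_two]

/-- The `√n` lost to Cauchy–Schwarz over the spectrum cancels the scaling `1/√n`, leaving the `1/n`
of the average. -/
lemma abs_linStat_sub_le {n : ℕ} {f : ℝ → ℝ} {K : ℝ} (hK : 0 ≤ K)
    (hf : ∀ x y, |f x - f y| ≤ K * |x - y|) (x y : Fin n × Fin n → ℂ) :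
    |linStat f x - linStat f y| ≤ K / n * √(∑ q, ‖x q - y q‖ ^ 2) := by
  have h := (scaledHermPart_isHermitian x).abs_sum_eigenvalues_sub_le
    (scaledHermPart_isHermitian y) hK hf
  unfold linStat
  rw [← mul_sub, abs_mul, abs_of_nonneg (by positivity : (0 : ℝ) ≤ (n : ℝ)⁻¹)]
  have h2 := Real.sqrt_le_sqrt (sum_norm_sq_scaledHermPart_sub_le x y)
  rw [Real.sqrt_mul (by positivity), Real.sqrt_inv] at h2
  rw [Fintype.card_fin] at h
  rcases Nat.eq_zero_or_pos n with rfl | hn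
  · simp
  have hn' : 0 < √(n : ℝ) := Real.sqrt_pos.2 (Nat.cast_pos.2 hn)
  calc (n : ℝ)⁻¹ * |_| ≤ (n : ℝ)⁻¹ * (K * √n * ((√n)⁻¹ * √(∑ q, ‖x q - y q‖ ^ 2))) := by
        refine mul_le_mul_of_nonneg_left (h.trans ?_) (by positivity)
        exact mul_le_mul_of_nonneg_left h2 (by positivity)
    _ = _ := by field_simp

/-- Linear statistics of convex functions have subgradients. -/
lemma hasSubgradients_linStat {n : ℕ} {g g' : ℝ → ℝ} {K : ℝ}
    (hg : ∀ x y, g x + g' x * (y - x) ≤ g y) (hK : ∀ x, |g' x| ≤ K) :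
    HasSubgradients (linStat (n := n) g) (K / n) := by
  intro x
  set hx := scaledHermPart_isHermitian x
  set H := hx.spectralMap g' with hH
  have hHh : ∀ i j, star (H j i) = H i j := (hx.spectralMap_isHermitian g').apply
  set c : ℝ := 1 / √(n : ℝ) with hc
  have hc2 : c ^ 2 = (n : ℝ)⁻¹ := by
    rw [hc, div_pow, Real.sq_sqrt (Nat.cast_nonneg n), one_pow, one_div]
  -- The transpose of `g'` applied to the scaled matrix, with factors from the average and the
  -- scaling. Its squared norm is at most `n⁻³ · n K² = (K/n)²`.
  refine ⟨fun q => (((n : ℝ)⁻¹ * c : ℝ) : ℂ) * H q.2 q.1, ?_, fun y => ?_⟩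
  · simp only [norm_mul, mul_pow, Complex.norm_real, Real.norm_eq_abs, sq_abs]
    rw [← Finset.mul_sum, Fintype.sum_prod_type, Finset.sum_comm, hx.sum_norm_sq_spectralMap,
      hc2, div_pow]
    have h1 : ∑ i, g' (hx.eigenvalues i) ^ 2 ≤ n * K ^ 2 := by
      refine (Finset.sum_le_sum fun i _ => sq_le_sq' (b := K) ?_ ?_).trans_eq (by simp)
      · exact (abs_le.1 (hK _)).1
      · exact (abs_le.1 (hK _)).2
    rcases Nat.eq_zero_or_pos n with rfl | hn
    · simp
    have hn' : (0 : ℝ) < n := Nat.cast_pos.2 hn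
    calc (n : ℝ)⁻¹ ^ 2 * (n : ℝ)⁻¹ * ∑ i, g' (hx.eigenvalues i) ^ 2
        ≤ (n : ℝ)⁻¹ ^ 2 * (n : ℝ)⁻¹ * (n * K ^ 2) := mul_le_mul_of_nonneg_left h1 (by positivity)
      _ = _ := by field_simp
  · have h := hx.sum_eigenvalues_sub_le (scaledHermPart_isHermitian y) hg
    unfold linStat
    rw [← mul_sub]
    refine (mul_le_mul_of_nonneg_left h (by positivity)).trans_eq ?_
    -- The Hermitian part yields two halves, which coincide after exchanging the summation indices.
    have hterm : ∀ i j, (H i j * (scaledHermPart x j i - scaledHermPart y j i)).re =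
        (c / 2) * (H i j * (x (j, i) - y (j, i))).re +
          (c / 2) * (H j i * (x (i, j) - y (i, j))).re := fun i j => by
      rw [scaledHermPart_sub_apply, ← hHh j i]
      simp only [Complex.star_def, Complex.mul_re, Complex.mul_im, Complex.ofReal_re,
        Complex.ofReal_im, Complex.conj_re, Complex.conj_im, Complex.div_ofNat_re,
        Complex.div_ofNat_im, Complex.add_re, Complex.add_im]
      ring
    rw [Matrix.trace, Complex.re_sum]
    simp only [Matrix.diag_apply, Matrix.mul_apply, Complex.re_sum, Matrix.sub_apply]
    rw [← hH]
    simp only [hterm, Finset.sum_add_distrib]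
    rw [Finset.sum_comm, ← two_mul, Fintype.sum_prod_type]
    simp only [Finset.mul_sum]
    refine Finset.sum_congr rfl fun i _ => Finset.sum_congr rfl fun j _ => ?_
    rw [mul_assoc (((n : ℝ)⁻¹ * c : ℝ) : ℂ), Complex.re_ofReal_mul]
    ring

end LinearStatistics

/-! ### Mean absolute deviation of linear statistics -/

section Concentration

/-- Nonnegativity of the variance of `|G - E G|` bounds its squared mean by the variance of `G`. -/
lemma integral_abs_sub_integral_le_sqrt {Ω : Type*} [MeasurableSpace Ω] {P : Measure Ω}
    [IsProbabilityMeasure P] {G : Ω → ℝ} (hG : MemLp G 2 P) {V : ℝ}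
    (hV : ∫ ω, G ω ^ 2 ∂P - (∫ ω, G ω ∂P) ^ 2 ≤ V) :
    ∫ ω, |G ω - ∫ ω', G ω' ∂P| ∂P ≤ √V := by
  have hU : MemLp (fun ω => |G ω - ∫ ω', G ω' ∂P|) 2 P := (hG.sub (memLp_const _)).abs
  have h1 := variance_eq_sub hU
  have h2 := variance_nonneg (fun ω => |G ω - ∫ ω', G ω' ∂P|) P
  have h3 := variance_eq_sub hG
  have h4 := variance_eq_integral (X := G) hG.1.aemeasurable
  simp only [Pi.pow_apply, sq_abs] at h1 h3 h4
  refine Real.le_sqrt_of_sq_le ?_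
  linarith

variable {n : ℕ}

lemma abs_linStat_le {f : ℝ → ℝ} {B : ℝ} (hB0 : 0 ≤ B) (hB : ∀ x, |f x| ≤ B)
    (x : Fin n × Fin n → ℂ) : |linStat f x| ≤ B := by
  unfold linStat
  rcases Nat.eq_zero_or_pos n with rfl | hn
  · simpa using hB0
  have hn' : (0 : ℝ) < n := Nat.cast_pos.2 hn
  rw [abs_mul, abs_of_pos (inv_pos.2 hn'), inv_mul_le_iff₀ hn']
  refine (Finset.abs_sum_le_sum_abs _ _).trans ((Finset.sum_le_sum fun i _ => hB _).trans_eq ?_)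
  simp

lemma linStat_sub (f g : ℝ → ℝ) (x : Fin n × Fin n → ℂ) :
    linStat f x - linStat g x = linStat (fun s => f s - g s) x := by
  simp [linStat, mul_sub]

/-- A linear statistic moves by at most `√ε` if the entries exceeding `t` have mean square at
most `ε`. -/
lemma abs_linStat_sub_truncEntries_le {f : ℝ → ℝ} (hf : ∀ x y, |f x - f y| ≤ |x - y|)
    {ε t : ℝ} {x : Fin n × Fin n → ℂ}
    (h : 1 / (n : ℝ) ^ 2 * ∑ i, ∑ j, (if t < ‖x (i, j)‖ then ‖x (i, j)‖ ^ 2 else 0) ≤ ε) :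
    |linStat f x - linStat f (truncEntries t x)| ≤ √ε := by
  refine (abs_linStat_sub_le zero_le_one (by simpa using hf) x _).trans ?_
  refine Real.le_sqrt_of_sq_le (le_trans (le_of_eq ?_) h)
  rw [mul_pow, Real.sq_sqrt (Finset.sum_nonneg fun q _ => sq_nonneg _), div_pow, one_pow,
    Fintype.sum_prod_type]
  congr 1
  refine Finset.sum_congr rfl fun i _ => Finset.sum_congr rfl fun j _ => ?_
  by_cases hq : t < ‖x (i, j)‖
  · simp [truncEntries, hq, not_le.2 hq]
  · simp [truncEntries, hq, not_lt.1 hq]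

/-- The mean absolute deviation of a linear statistic of a random matrix with independent blocks,
for a test function close to a difference of convex functions with bounded subgradients. -/
theorem integral_abs_linStat_sub_integral_le {Ω : Type*} [MeasurableSpace Ω] {P : Measure Ω}
    [IsProbabilityMeasure P] {X : Ω → Fin n × Fin n → ℂ} (hX : Measurable X)
    (Q : Finpartition (Finset.univ : Finset (Fin n × Fin n)))
    (hind : iIndepFun (fun (p : Q.parts) (ω : Ω) (q : p.1) => X ω q) P) {d : ℝ} (hd0 : 0 ≤ d)
    (hd : ∀ p ∈ Q.parts, (p.card : ℝ) ≤ d) {f g g' h h' : ℝ → ℝ} {B K δ ε t : ℝ}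
    (hf : ∀ x y, |f x - f y| ≤ |x - y|) (hB0 : 0 ≤ B) (hB : ∀ x, |f x| ≤ B) (hK0 : 0 ≤ K)
    (hδ : 0 ≤ δ) (ht : 0 ≤ t)
    (happrox : ∀ x, |f x - (g x - h x)| ≤ δ)
    (hg : ∀ x y, g x + g' x * (y - x) ≤ g y) (hgK : ∀ x, |g' x| ≤ K)
    (hh : ∀ x y, h x + h' x * (y - x) ≤ h y) (hhK : ∀ x, |h' x| ≤ K) :
    ∫ ω, |linStat f (X ω) - ∫ ω', linStat f (X ω') ∂P| ∂P ≤
      2 * (√ε + δ + 2 * B * P.real {ω | ε < 1 / (n : ℝ) ^ 2 *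
        ∑ i, ∑ j, (if t < ‖X ω (i, j)‖ then ‖X ω (i, j)‖ ^ 2 else 0)}) +
      2 * √(4 * (K / n) ^ 2 * t ^ 2 * d) := by
  set S := {ω | ε < 1 / (n : ℝ) ^ 2 *
        ∑ i, ∑ j, (if t < ‖X ω (i, j)‖ then ‖X ω (i, j)‖ ^ 2 else 0)} with hS
  have hSm : MeasurableSet S := by
    refine measurableSet_lt measurable_const (measurable_const.mul ?_)
    refine Finset.measurable_sum _ fun i _ => Finset.measurable_sum _ fun j _ => ?_
    have : Measurable fun ω => ‖X ω (i, j)‖ := by fun_prop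
    exact Measurable.ite (measurableSet_lt measurable_const this) (this.pow_const 2)
      measurable_const
  have hKn : 0 ≤ K / n := by positivity
  have hYm : Measurable fun ω => truncEntries t (X ω) := (measurable_truncEntries t).comp hX
  have hstat : ∀ {k k' : ℝ → ℝ}, (∀ x y, k x + k' x * (y - x) ≤ k y) → (∀ x, |k' x| ≤ K) →
      MemLp (fun ω => linStat k (truncEntries t (X ω))) 2 P ∧
      ∫ ω, |linStat k (truncEntries t (X ω)) - ∫ ω', linStat k (truncEntries t (X ω')) ∂P| ∂P ≤
        √(4 * (K / n) ^ 2 * t ^ 2 * d) := fun {k k'} hk hkK => by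
    have hsub := hasSubgradients_linStat (n := n) hk hkK
    have hm : MemLp (fun ω => linStat k (truncEntries t (X ω))) 2 P := by
      refine MemLp.of_bound ?_ _ (Eventually.of_forall fun ω =>
        hsub.abs_truncEntries_le hKn ht (X ω))
      exact ((continuous_of_abs_sub_le_sqrt (hsub.abs_sub_le hKn)).measurable.comp
        hYm).aestronglyMeasurable
    exact ⟨hm, integral_abs_sub_integral_le_sqrt hm
      (hsub.variance_le hKn ht hX Q hind hd0 hd)⟩
  obtain ⟨hgm, hgV⟩ := hstat hg hgK
  obtain ⟨hhm, hhV⟩ := hstat hh hhK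
  have hgi := hgm.integrable one_le_two
  have hhi := hhm.integrable one_le_two
  have hfc : Continuous (linStat (n := n) f) :=
    continuous_of_abs_sub_le_sqrt (abs_linStat_sub_le zero_le_one (by simpa using hf))
  have hZi : Integrable (fun ω => linStat f (X ω)) P :=
    Integrable.of_bound (hfc.measurable.comp hX).aestronglyMeasurable B
      (Eventually.of_forall fun ω => abs_linStat_le hB0 hB (X ω))
  set Z := fun ω => linStat f (X ω) with hZ
  set G := fun ω => linStat g (truncEntries t (X ω)) with hG
  set H := fun ω => linStat h (truncEntries t (X ω)) with hH
  -- Off `S` truncation costs `√ε`; on `S` only the bound `2 B` is available. The convex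
  -- approximation costs `δ`.
  have hpt : ∀ ω, |Z ω - (G ω - H ω)| ≤ √ε + δ + S.indicator (fun _ => 2 * B) ω := fun ω => by
    have h1 : |linStat f (truncEntries t (X ω)) - (G ω - H ω)| ≤ δ := by
      rw [hG, hH]
      simp only [linStat_sub]
      exact abs_linStat_le hδ happrox _
    have h2 : |Z ω - linStat f (truncEntries t (X ω))| ≤
        √ε + S.indicator (fun _ => 2 * B) ω := by
      by_cases hω : ω ∈ S
      · rw [Set.indicator_of_mem hω]
        have := abs_le.1 (abs_linStat_le hB0 hB (X ω))
        have := abs_le.1 (abs_linStat_le hB0 hB (truncEntries t (X ω)))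
        refine abs_le.2 ⟨?_, ?_⟩ <;> simp only [hZ] <;> linarith [Real.sqrt_nonneg ε]
      · rw [Set.indicator_of_notMem hω, add_zero]
        exact abs_linStat_sub_truncEntries_le hf (not_lt.1 hω)
    have h3 := abs_sub_le (Z ω) (linStat f (truncEntries t (X ω))) (G ω - H ω)
    linarith
  have hRi : Integrable (fun ω => Z ω - (G ω - H ω)) P := hZi.sub (hgi.sub hhi)
  have hR : ∫ ω, |Z ω - (G ω - H ω)| ∂P ≤ √ε + δ + 2 * B * P.real S := by
    have hIi : Integrable (S.indicator fun _ => 2 * B) P := (integrable_const _).indicator hSm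
    refine (integral_mono hRi.abs ((integrable_const _).add hIi) hpt).trans_eq ?_
    rw [Pi.add_def, integral_add (integrable_const _) hIi, integral_indicator_const _ hSm]
    simp [mul_comm]
  have hEW : ∫ ω, Z ω ∂P - (∫ ω, G ω ∂P - ∫ ω, H ω ∂P) = ∫ ω, (Z ω - (G ω - H ω)) ∂P := by
    have hGH : Integrable (fun ω => G ω - H ω) P := hgi.sub hhi
    rw [integral_sub hZi hGH, integral_sub hgi hhi]
  have hER : |∫ ω, (Z ω - (G ω - H ω)) ∂P| ≤ ∫ ω, |Z ω - (G ω - H ω)| ∂P :=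
    abs_integral_le_integral_abs
  have hgi' : Integrable (fun ω => |G ω - ∫ ω', G ω' ∂P|) P := (hgi.sub (integrable_const _)).abs
  have hhi' : Integrable (fun ω => |H ω - ∫ ω', H ω' ∂P|) P := (hhi.sub (integrable_const _)).abs
  -- Split `Z - E Z` into the centred `G`, the centred `H`, and the error `Z - (G - H)` minus its
  -- mean. The error is thus counted twice.
  have hfin : ∫ ω, |Z ω - ∫ ω', Z ω' ∂P| ∂P ≤
      ∫ ω, (|Z ω - (G ω - H ω)| + |G ω - ∫ ω', G ω' ∂P| + |H ω - ∫ ω', H ω' ∂P| +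
        |∫ ω, (Z ω - (G ω - H ω)) ∂P|) ∂P := by
    refine integral_mono (hZi.sub (integrable_const _)).abs
      (((hRi.abs.add hgi').add hhi').add (integrable_const _)) fun ω => ?_
    simp only [← hEW]
    have h1 := abs_le.1 (le_refl |Z ω - (G ω - H ω)|)
    have h2 := abs_le.1 (le_refl |G ω - ∫ ω', G ω' ∂P|)
    have h3 := abs_le.1 (le_refl |H ω - ∫ ω', H ω' ∂P|)
    have h4 := abs_le.1 (le_refl |∫ ω, Z ω ∂P - (∫ ω, G ω ∂P - ∫ ω, H ω ∂P)|)
    exact abs_le.2 ⟨by linarith [h1.1, h2.1, h3.2, h4.2], by linarith [h1.2, h2.2, h3.1, h4.1]⟩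
  have h2i : Integrable (fun ω => |Z ω - (G ω - H ω)| + |G ω - ∫ ω', G ω' ∂P|) P :=
    hRi.abs.add hgi'
  have h3i : Integrable (fun ω => |Z ω - (G ω - H ω)| + |G ω - ∫ ω', G ω' ∂P| +
      |H ω - ∫ ω', H ω' ∂P|) P := h2i.add hhi'
  rw [integral_add h3i (integrable_const _), integral_add h2i hhi', integral_add hRi.abs hgi']
    at hfin
  simp only [integral_const, probReal_univ, one_smul] at hfin
  linarith

end Concentration

/-! ### Proof of the theorem -/

theorem mainTheorem2 {Ω : ℕ → Type*} [∀ n, MeasurableSpace (Ω n)]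
    (P : ∀ n, Measure (Ω n)) [∀ n, IsProbabilityMeasure (P n)]
    (X : ∀ n, Ω n → HermMat n)
    (hX : ∀ n i j, Measurable fun ω => (X n ω : Matrix (Fin n) (Fin n) ℂ) i j)
    (a d : ℕ → ℝ) (ha : Tendsto a atTop atTop)
    (hd : d =O[atTop] fun n : ℕ => (n : ℝ) ^ 2 / a n ^ 2)
    (hblocks : ∀ n, IndepBlocks (fun ω => (X n ω : Matrix (Fin n) (Fin n) ℂ)) (P n) (d n))
    (hL : LindebergCond (fun n ω => (X n ω : Matrix (Fin n) (Fin n) ℂ)) P a)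
    (f : ℝ → ℝ) (hfc : HasCompactSupport f) (hfL : LipschitzWith 1 f) :
    (∀ n : ℕ, Integrable (fun ω => ∫ x, f x ∂(empSpecDist ((1 / √(n : ℝ)) • X n ω))) (P n)) ∧
    TendstoZeroInProb
      (fun n ω => (∫ x, f x ∂(empSpecDist ((1 / √(n : ℝ)) • X n ω))) -
        ∫ ω', (∫ x, f x ∂(empSpecDist ((1 / √(n : ℝ)) • X n ω'))) ∂(P n)) P := by
  have hf : ∀ x y, |f x - f y| ≤ |x - y| := fun x y => by
    simpa [Real.dist_eq] using hfL.dist_le_mul x y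
  obtain ⟨B, hB⟩ := hfc.exists_bound_of_continuous hfL.continuous
  have hB0 : 0 ≤ B := (norm_nonneg _).trans (hB 0)
  simp only [integral_empSpecDist]
  set x : ∀ n, Ω n → Fin n × Fin n → ℂ := fun n ω q =>
    (X n ω : Matrix (Fin n) (Fin n) ℂ) q.1 q.2 with hx
  have hxm : ∀ n, Measurable (x n) := fun n => measurable_pi_iff.2 fun q => hX n q.1 q.2
  have hZi : ∀ n, Integrable (fun ω => linStat f (x n ω)) (P n) := fun n => by
    have hc : Continuous (linStat (n := n) f) :=
      continuous_of_abs_sub_le_sqrt (abs_linStat_sub_le zero_le_one (by simpa using hf))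
    exact Integrable.of_bound (hc.measurable.comp (hxm n)).aestronglyMeasurable B
      (Eventually.of_forall fun ω => abs_linStat_le hB0 hB (x n ω))
  refine ⟨hZi, fun r hr => ?_⟩
  set D : ℕ → ℝ := fun n => ∫ ω, |linStat f (x n ω) - ∫ ω', linStat f (x n ω') ∂(P n)| ∂(P n)
    with hD
  have hD0 : ∀ n, 0 ≤ D n := fun n => integral_nonneg fun ω => abs_nonneg _
  -- By Markov's inequality, convergence in mean suffices.
  suffices hDlim : Tendsto D atTop (𝓝 0) by
    have hmarkov : ∀ n, P n {ω | r ≤ |linStat f (x n ω) - ∫ ω', linStat f (x n ω') ∂(P n)|} ≤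
        ENNReal.ofReal (D n / r) := fun n => by
      rw [← ofReal_measureReal]
      refine ENNReal.ofReal_le_ofReal ((le_div_iff₀' hr).2 ?_)
      exact mul_meas_ge_le_integral_of_nonneg (Eventually.of_forall fun ω => abs_nonneg _)
        ((hZi n).sub (integrable_const _)).abs r
    refine tendsto_of_tendsto_of_tendsto_of_le_of_le tendsto_const_nhds ?_ (fun n => zero_le)
      hmarkov
    simpa using ENNReal.tendsto_ofReal (hDlim.div_const r)
  obtain ⟨C, hC0, hC⟩ := hd.exists_pos
  rw [isBigOWith_iff] at hC
  refine Metric.tendsto_nhds.2 fun η hη => ?_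
  obtain ⟨K, g, g', h, h', hK0, happrox, hg, hgK, hh, hhK⟩ :=
    exists_convex_sub_convex_approx hfc hfL (by positivity : 0 < η / 16)
  -- The first bound controls the truncation error `√ε`, the second the fluctuation `K √C ε`. `K` is
  -- already fixed by the approximation at accuracy `η / 16`.
  set ε : ℝ := min ((η / 16) ^ 2) (η / (16 * (K * √C + 1))) with hε
  have hε0 : 0 < ε := lt_min (by positivity) (by positivity)
  have hε1 : √ε ≤ η / 16 :=
    (Real.sqrt_le_sqrt (min_le_left _ _)).trans_eq (Real.sqrt_sq (by positivity))
  have hε2 : K * √C * ε ≤ η / 16 := by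
    have h1 : ε * (16 * (K * √C + 1)) ≤ η :=
      (le_div_iff₀ (by positivity)).1 (min_le_right _ _)
    nlinarith
  have hlim := tendsto_of_le_liminf_of_limsup_le zero_le (hL ε hε0).le
  have hlim' := (ENNReal.tendsto_toReal ENNReal.zero_ne_top).comp hlim
  have hsmall := hlim'.eventually (gt_mem_nhds
    (by simp only [ENNReal.toReal_zero]; positivity : ENNReal.toReal 0 < η / (16 * (B + 1))))
  filter_upwards [hC, hsmall, ha.eventually_gt_atTop 0, eventually_gt_atTop 0]
    with n hdn hpn han hn
  have hn' : (0 : ℝ) < n := Nat.cast_pos.2 hn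
  obtain ⟨Q, hind, hcard⟩ := hblocks n
  rw [Real.norm_of_nonneg (by positivity : 0 ≤ (n : ℝ) ^ 2 / a n ^ 2)] at hdn
  have hdn' : d n ≤ C * ((n : ℝ) ^ 2 / a n ^ 2) := (Real.le_norm_self _).trans hdn
  -- The block size is bounded by `C n² / a_n²`, which is nonnegative, rather than by `d n`, whose
  -- sign is not assumed.
  have hmain := integral_abs_linStat_sub_integral_le (hxm n) Q hind
    (d := C * ((n : ℝ) ^ 2 / a n ^ 2)) (by positivity) (fun p hp => (hcard p hp).trans hdn')
    (ε := ε) (t := ε * a n) hf hB0 hB hK0 (by positivity) (by positivity)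
    happrox hg hgK hh hhK
  have hV : √(4 * (K / n) ^ 2 * (ε * a n) ^ 2 * (C * ((n : ℝ) ^ 2 / a n ^ 2))) =
      2 * (K * √C * ε) := by
    rw [show 4 * (K / n) ^ 2 * (ε * a n) ^ 2 * (C * ((n : ℝ) ^ 2 / a n ^ 2)) =
      (2 * (K * √C * ε)) ^ 2 by
        simp only [mul_pow, Real.sq_sqrt hC0.le]
        field_simp
        ring]
    exact Real.sqrt_sq (by positivity)
  rw [hV] at hmain
  rw [Real.dist_eq, sub_zero, abs_of_nonneg (hD0 n)]
  have hp : 2 * B * (P n).real {ω | ε < 1 / (n : ℝ) ^ 2 *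
      ∑ i, ∑ j, (if ε * a n < ‖x n ω (i, j)‖ then ‖x n ω (i, j)‖ ^ 2 else 0)} ≤ η / 8 := by
    have h1 := (lt_div_iff₀ (by positivity)).1 hpn
    set p := (P n).real {ω | ε < 1 / (n : ℝ) ^ 2 *
      ∑ i, ∑ j, (if ε * a n < ‖x n ω (i, j)‖ then ‖x n ω (i, j)‖ ^ 2 else 0)}
    change p * (16 * (B + 1)) < η at h1
    have h2 : 0 ≤ p := measureReal_nonneg
    nlinarith
  refine lt_of_le_of_lt hmain ?_
  -- The errors add up to at most `2 (η/16 + η/16 + η/8) + 4 η/16 = 3η/4`.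
  linarith
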